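/- Let $I,O$ be finite disjoint sets of input and output signals, let $\varphi$ be an $\mathrm{LTL}[\mathcal F]$ formula over $I\cup O$, and let $\psi$ be an $\mathrm{LTL}$ formula over $I$. (Here $\mathcal F$ is any set of functions $[0,1]^k\to[0,1]$, $k\in\mathbb N$; formulas are built from $\mathtt{True}$, $\mathtt{False}$, atomic propositions, functions in $\mathcal F$, $\mathsf X$ and $\mathsf U$, and the satisfaction value $[\![\pi,\varphi]\!]\in[0,1]$ in $\pi\in(2^{I\cup O})^\omega$ is defined as usual, with $\mathsf U$ interpreted by $\max_i\min\{[\![\pi^i,\varphi_2]\!],\min_{j<i}[\![\pi^j,\varphi_1]\!]\}$.) Equip $(2^I)^\omega$ with the uniform (i.i.d. uniform letters) distribution and assume $\Pr(w\models\psi)>0$. Let $V(\varphi)=\{[\![\pi,\varphi]\!]:\pi\in(2^{I\cup O})^\omega\}=\{v_1<\dots<v_n\}$. Let $\mathcal A_\psi$ be a deterministic parity automaton (DPW; total transition function, finitely many states, a run accepts iff the maximal rank of the states visited infinitely often is even) over $2^I$ with language $\{w:w\models\psi\}$, and for each $l$ let $\mathcal A_l$ be a DPW over $2^{I\cup O}$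 with state set $Q^l$, rank function $\alpha^l$ and language $\{\pi:[\![\pi,\varphi]\!]=v_l\}$. A transition function $\delta$ on a state set $Q$ over $2^{I\cup O}$ induces transition probabilities $\mathrm P(q,o,q')=|\{i\in2^I:\delta(q,i\cup o)=q'\}|/2^{|I|}$ with actions $o\in 2^O$. An end component is a set $C$ of states for which there are nonempty action sets $(B_s)_{s\in C}$ such that any two states of $C$ are connected by a path inside $C$ using positive-probability transitions of actions in the sets $B_s$, and such that from $s\in C$ under any $a\in B_s$ the next state is in $C$ with probability $1$. *The MDP $\mathcal M$.* Its states are those of the product $\mathcal A_\psi\times\mathcal A_1\times\dots\times\mathcal A_n$ (where $\mathcal A_\psi$ ignores the output part of a letter), its initial state $s_0$ is the tuple of initial states, its actions are $2^O$ in every state, and its transition probabilities are those induced by the product. The reward $\gamma(s)$ of a state $s=\langle q,q_1,\dots,q_n\rangle$ that lies in some end component of $\mathcal M$ is the largest $v_l$ such that $q_l$ belongs to an end component $U$ of the MDP induced by $\mathcal A_l$ in which the maximal rank $\max_{p\in U}\alpha^l(p)$ is even ($0$ if there is no such $l$); all other states have reward $0$. *The reset MDP $\mathcal M'$.* It is $\mathcal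 M$, except that from every state whose $\mathcal A_\psi$-component lies in a rejecting ergodic component every action leads to $s_0$ with probability $1$. Here an ergodic component is a nonempty strongly connected set of states, closed under positive-probability transitions, of the Markov chain obtained by running $\mathcal A_\psi$ on uniformly random letters of $2^I$; it is rejecting if the maximal rank in it is odd. A strategy is a function $f:S^+\to 2^O$ from nonempty state sequences to actions. The reward of an infinite run $s_0,s_1,\dots$ is $\liminf_{m\to\infty}\frac1m\sum_{j=0}^m\gamma(s_j)$. For a strategy $f$, let $R_{\mathcal M,f}$ be the reward of the run generated by $f$ in $\mathcal M$ on the random input word $w=i_0i_1\cdots$ (in history $s_0\cdots s_j$ the next state is the successor of $s_j$ under the letter $i_j\cup f(s_0\cdots s_j)$), and for a strategy $g$ let $R_{\mathcal M',g}$ be the reward of a random run of the Markov chain induced by $g$ in $\mathcal M'$. Then for every $v\in\mathbb R$: if $f$ is a strategy in $\mathcal M$ with $\mathbb E[R_{\mathcal M,f}\mid w\models\psi]\ge v$, then there is a strategy $g$ in $\mathcal M'$ with $\mathbb E[R_{\mathcal M',g}]\ge v$. -/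

import Mathlib

/-!
Signals: `I` (inputs) and `O` (outputs) are finite types; a letter of `2^I` is a `Finset I`, a letter
of `2^{I ∪ O}` is a `Finset (I ⊕ O)`, and `i ∪ o` is `Finset.disjSum i o`. An infinite word over `Σ`
is a function `ℕ → Σ`.
-/

noncomputable section

open MeasureTheory ProbabilityTheory Filter

namespace QualSynth

/-! ### Temporal logics -/

/-- The suffix `π_j, π_{j+1}, …` of an infinite word. -/
def suffix {σ : Type*} (π : ℕ → σ) (j : ℕ) : ℕ → σ := fun k => π (j + k)

/-- Formulas of LTL[F] over the atomic propositions `AP`; `F k` is the set of `k`-ary quality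
operators `[0,1]^k → [0,1]`. -/
inductive FLTL (AP : Type*) (F : (k : ℕ) → Set ((Fin k → unitInterval) → unitInterval))
  | tt : FLTL AP F
  | ff : FLTL AP F
  | atom (p : AP) : FLTL AP F
  | op {k : ℕ} (f : (Fin k → unitInterval) → unitInterval) (hf : f ∈ F k)
      (args : Fin k → FLTL AP F) : FLTL AP F
  | next (φ : FLTL AP F) : FLTL AP F
  | untl (φ₁ φ₂ : FLTL AP F) : FLTL AP F

open Classical in
/-- The satisfaction value of an LTL[F] formula in a computation. -/
def FLTL.sem {AP : Type*} {F : (k : ℕ) → Set ((Fin k → unitInterval) → unitInterval)} :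
    FLTL AP F → (ℕ → Finset AP) → unitInterval
  | .tt, _ => 1
  | .ff, _ => 0
  | .atom p, π => if p ∈ π 0 then 1 else 0
  | .op f _ args, π => f (fun l => (args l).sem π)
  | .next φ, π => φ.sem (suffix π 1)
  | .untl φ₁ φ₂, π =>
      ⨆ i : ℕ, min (φ₂.sem (suffix π i)) (⨅ j : Fin i, φ₁.sem (suffix π j))

/-- `V(φ)`: the set of satisfaction values of `φ` in arbitrary computations. -/
def FLTL.values {AP : Type*} {F : (k : ℕ) → Set ((Fin k → unitInterval) → unitInterval)}
    (φ : FLTL AP F) : Set ℝ :=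
  Set.range fun π : ℕ → Finset AP => (φ.sem π : ℝ)

/-- Formulas of (Boolean) linear temporal logic. -/
inductive LTL (AP : Type*)
  | tt : LTL AP
  | ff : LTL AP
  | atom (p : AP) : LTL AP
  | neg (ψ : LTL AP) : LTL AP
  | conj (ψ₁ ψ₂ : LTL AP) : LTL AP
  | disj (ψ₁ ψ₂ : LTL AP) : LTL AP
  | next (ψ : LTL AP) : LTL AP
  | untl (ψ₁ ψ₂ : LTL AP) : LTL AP

/-- `w ⊨ ψ`. -/
def LTL.Sat {AP : Type*} : LTL AP → (ℕ → Finset AP) → Prop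
  | .tt, _ => True
  | .ff, _ => False
  | .atom p, w => p ∈ w 0
  | .neg ψ, w => ¬ ψ.Sat w
  | .conj ψ₁ ψ₂, w => ψ₁.Sat w ∧ ψ₂.Sat w
  | .disj ψ₁ ψ₂, w => ψ₁.Sat w ∨ ψ₂.Sat w
  | .next ψ, w => ψ.Sat (suffix w 1)
  | .untl ψ₁ ψ₂, w => ∃ i, ψ₂.Sat (suffix w i) ∧ ∀ j < i, ψ₁.Sat (suffix w j)

/-! ### Deterministic parity automata -/

/-- A deterministic parity automaton with alphabet `σ` and state space `Q`. -/
structure DPW (σ Q : Type*) where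
  init : Q
  step : Q → σ → Q
  index : ℕ
  rank : Q → ℕ
  rank_mem : ∀ q, rank q ∈ Set.Icc 1 index

/-- The run of the automaton on a word. -/
def DPW.run {σ Q : Type*} (A : DPW σ Q) (w : ℕ → σ) : ℕ → Q
  | 0 => A.init
  | j + 1 => A.step (A.run w j) (w j)

/-- The states that occur infinitely often in a run. -/
def infStates {Q : Type*} (r : ℕ → Q) : Set Q := {q | ∃ᶠ j in atTop, r j = q}

/-- The language of the automaton: the maximal rank occurring infinitely often is even. -/
def DPW.language {σ Q : Type*} (A : DPW σ Q) : Set (ℕ → σ) :=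
  {w | ∃ m, IsGreatest (A.rank '' infStates (A.run w)) m ∧ Even m}

/-! ### Markov chains and Markov decision processes -/

/-- A Markov chain with (countable) state space `S`. -/
structure MarkovChain (S : Type*) where
  init : S
  trans : S → PMF S

/-- The `n`-th step of the chain as a kernel from the first `n + 1` states to the next state. -/
def MarkovChain.stepKernel {S : Type*} [Countable S] [MeasurableSpace S]
    [DiscreteMeasurableSpace S] (M : MarkovChain S) (n : ℕ) :
    Kernel ((i : Finset.Iic n) → (fun _ : ℕ => S) i) S :=
  (Kernel.ofFunOfCountable fun s => (M.trans s).toMeasure).comap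
    (fun h => h ⟨n, Finset.mem_Iic.2 le_rfl⟩) (measurable_pi_apply _)

instance {S : Type*} [Countable S] [MeasurableSpace S] [DiscreteMeasurableSpace S]
    (M : MarkovChain S) (n : ℕ) : IsMarkovKernel (M.stepKernel n) :=
  ⟨fun h => inferInstanceAs (IsProbabilityMeasure
    (M.trans (h ⟨n, Finset.mem_Iic.2 le_rfl⟩)).toMeasure)⟩

/-- The probability measure induced by the chain on its infinite runs. -/
def MarkovChain.runMeasure {S : Type*} [Countable S] [MeasurableSpace S]
    [DiscreteMeasurableSpace S] (M : MarkovChain S) : Measure (ℕ → S) :=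
  Kernel.traj (X := fun _ => S) M.stepKernel 0 (fun _ => M.init)

/-- An ergodic component: strongly connected, and closed under transitions of positive
probability. -/
def MarkovChain.IsErgodicComponent {S : Type*} (M : MarkovChain S) (C : Set S) : Prop :=
  C.Nonempty ∧
  (∀ s ∈ C, ∀ t ∈ C,
    Relation.ReflTransGen (fun x y => x ∈ C ∧ y ∈ C ∧ 0 < M.trans x y) s t) ∧
  ∀ s ∈ C, ∀ t ∉ C, M.trans s t = 0

/-- `S⁺`: the pair of `past = t ∈ S^*` and `cur = s ∈ S` stands for the nonempty sequence `t · s`. -/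
@[ext]
structure History (S : Type*) where
  past : List S
  cur : S

/-- The history `t · s · s'`. -/
def History.snoc {S : Type*} (u : History S) (s : S) : History S := ⟨u.past ++ [u.cur], s⟩

instance {S : Type*} : MeasurableSpace (History S) := ⊤

instance {S : Type*} : DiscreteMeasurableSpace (History S) := ⟨fun _ => trivial⟩

instance {S : Type*} [Countable S] : Countable (History S) :=
  Function.Injective.countable (f := fun u : History S => (u.past, u.cur)) fun u v h => by
    cases u; cases v; simpa using h

/-- A Markov decision process with state space `S`, in which all the actions of `A` are available
in every state. -/
structure MDP (S A : Type*) where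
  init : S
  trans : S → A → PMF S
  reward : S → ℝ

/-- A (deterministic, history-dependent) strategy `S⁺ → A`. -/
abbrev Strategy (S A : Type*) := History S → A

/-- The Markov chain on `S⁺` in which the choice of actions is resolved by `f`. -/
def MDP.chain {S A : Type*} (M : MDP S A) (f : Strategy S A) : MarkovChain (History S) where
  init := ⟨[], M.init⟩
  trans u := (M.trans u.cur (f u)).map u.snoc

/-- The mean payoff `liminf_m (1/m) ∑_{j=0}^m γ(s_j)` of a run of the chain induced by a strategy. -/
def MDP.payoff {S A : Type*} (M : MDP S A) (r : ℕ → History S) : ℝ :=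
  liminf (fun m : ℕ => (1 / (m : ℝ)) * ∑ j ∈ Finset.range (m + 1), M.reward (r j).cur) atTop

/-- The value of a strategy: its expected mean payoff. -/
def MDP.val {S A : Type*} [Countable S] (M : MDP S A) (f : Strategy S A) : ℝ :=
  ∫ r, M.payoff r ∂(M.chain f).runMeasure

/-- An end component with respect to the transition function `P`. -/
def IsEndComponent {S A : Type*} (P : S → A → PMF S) (C : Set S) : Prop :=
  ∃ B : S → Set A,
    (∀ s ∈ C, (B s).Nonempty) ∧
    (∀ s ∈ C, ∀ t ∈ C,
      Relation.ReflTransGen (fun x y => x ∈ C ∧ y ∈ C ∧ ∃ a ∈ B x, 0 < P x a y) s t) ∧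
    ∀ s ∈ C, ∀ a ∈ B s, ∑' t : C, P s a t = 1

/-! ### The MDPs of the synthesis problem -/

/-- The transition function of the pre-MDP induced by a transition function over `2^{I ∪ O}`:
when action `o` is chosen in `q`, an input `i` is sampled uniformly and the next state is
`δ(q, i ∪ o)`. -/
def inducedTrans {I O Q : Type*} [Fintype I] (δ : Q → Finset (I ⊕ O) → Q) (q : Q) (o : Finset O) :
    PMF Q :=
  (PMF.uniformOfFintype (Finset I)).map fun i => δ q (i.disjSum o)

/-- `q` is a controllably win recurrent state of the parity MDP of `A`, with witness `U`. -/
def IsCWR {I O Q : Type*} [Fintype I] (A : DPW (Finset (I ⊕ O)) Q) (q : Q) (U : Set Q) : Prop :=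
  IsEndComponent (inducedTrans A.step) U ∧ q ∈ U ∧ (∀ p ∈ U, A.rank p ≤ A.rank q) ∧
    Even (A.rank q)

/-- The Markov chain obtained by running an automaton over `2^I` on uniformly random inputs. -/
def inputChain {I Q : Type*} [Fintype I] (A : DPW (Finset I) Q) : MarkovChain Q where
  init := A.init
  trans q := (PMF.uniformOfFintype (Finset I)).map fun i => A.step q i

/-- A rejecting ergodic component: the maximal rank that appears in it is odd. -/
def IsRejectingComponent {I Q : Type*} [Fintype I] (A : DPW (Finset I) Q) (C : Set Q) : Prop :=
  (inputChain A).IsErgodicComponent C ∧ ∃ m, IsGreatest (A.rank '' C) m ∧ Odd m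

/-- The transition function of the product `A_ψ × A_1 × ⋯ × A_n`; `A_ψ` reads only the input part of
the letter. -/
def prodStep {I O : Type*} {n : ℕ} {Qψ : Type*} {Q : Fin n → Type*} (Aψ : DPW (Finset I) Qψ)
    (A : ∀ l, DPW (Finset (I ⊕ O)) (Q l)) (s : Qψ × (∀ l, Q l)) (a : Finset (I ⊕ O)) :
    Qψ × (∀ l, Q l) :=
  (Aψ.step s.1 a.toLeft, fun l => (A l).step (s.2 l) a)

open Classical in
/-- The conditional achievability MDP. The reward of a state that lies in some end component is the
maximal value achievable from it; the reward of all other states is `0`. -/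
def condMDP {I O : Type*} [Fintype I] {n : ℕ} {Qψ : Type*} {Q : Fin n → Type*}
    (Aψ : DPW (Finset I) Qψ) (v : Fin n → ℝ) (A : ∀ l, DPW (Finset (I ⊕ O)) (Q l)) :
    MDP (Qψ × (∀ l, Q l)) (Finset O) where
  init := (Aψ.init, fun l => (A l).init)
  trans := inducedTrans (prodStep Aψ A)
  reward s :=
    if ∃ C, IsEndComponent (inducedTrans (prodStep Aψ A)) C ∧ s ∈ C then
      sSup {x | ∃ l, v l = x ∧ ∃ q U, IsCWR (A l) q U ∧ s.2 l ∈ U}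
    else 0

open Classical in
/-- The reset MDP: from every state whose `A_ψ`-component lies in a rejecting ergodic component,
every action leads back to the initial state with probability one. -/
def resetMDP {I O : Type*} [Fintype I] {n : ℕ} {Qψ : Type*} {Q : Fin n → Type*}
    (Aψ : DPW (Finset I) Qψ) (v : Fin n → ℝ) (A : ∀ l, DPW (Finset (I ⊕ O)) (Q l)) :
    MDP (Qψ × (∀ l, Q l)) (Finset O) where
  init := (condMDP Aψ v A).init
  trans s o :=
    if ∃ C, IsRejectingComponent Aψ C ∧ s.1 ∈ C then PMF.pure (condMDP Aψ v A).init
    else (condMDP Aψ v A).trans s o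
  reward := (condMDP Aψ v A).reward

/-- The uniform distribution on `(2^I)^ω`. -/
def inputMeasure (I : Type*) [Fintype I] : Measure (ℕ → Finset I) :=
  Measure.infinitePi fun _ => (PMF.uniformOfFintype (Finset I)).toMeasure

/-- The run that a strategy generates, in the MDP of a pre-automaton over `2^{I ∪ O}`, on an input
word: in history `u` the strategy chooses `f u`, and the state moves according to the letter
`w_j ∪ f u`. -/
def inputRun {I O S : Type*} (δ : S → Finset (I ⊕ O) → S) (s₀ : S)
    (f : Strategy S (Finset O)) (w : ℕ → Finset I) : ℕ → History S
  | 0 => ⟨[], s₀⟩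
  | j + 1 =>
      (inputRun δ s₀ f w j).snoc
        (δ (inputRun δ s₀ f w j).cur ((w j).disjSum (f (inputRun δ s₀ f w j))))

/-- The random variable that maps an input word to the mean payoff of the run generated on it by the
strategy `f` in the conditional achievability MDP. -/
def condReward {I O : Type*} [Fintype I] {n : ℕ} {Qψ : Type*} {Q : Fin n → Type*}
    (Aψ : DPW (Finset I) Qψ) (v : Fin n → ℝ) (A : ∀ l, DPW (Finset (I ⊕ O)) (Q l))
    (f : Strategy (Qψ × (∀ l, Q l)) (Finset O)) (w : ℕ → Finset I) : ℝ :=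
  (condMDP Aψ v A).payoff (inputRun (prodStep Aψ A) (condMDP Aψ v A).init f w)

/-- The conditional expectation of the mean payoff of `f` given `w ⊨ ψ`. -/
def condVal {I O : Type*} [Fintype I] {n : ℕ} {Qψ : Type*} {Q : Fin n → Type*}
    (ψ : LTL I) (Aψ : DPW (Finset I) Qψ) (v : Fin n → ℝ)
    (A : ∀ l, DPW (Finset (I ⊕ O)) (Q l))
    (f : Strategy (Qψ × (∀ l, Q l)) (Finset O)) : ℝ :=
  ∫ w, condReward Aψ v A f w ∂(cond (inputMeasure I) {w | ψ.Sat w})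

/-! ### Consistency of the two descriptions of random runs -/

/-- The run measure is the one given by the cylinder sets: `Pr(Cone(r)) = Pr(r)`. -/
theorem MarkovChain.runMeasure_cone {S : Type*} [Countable S] [MeasurableSpace S]
    [DiscreteMeasurableSpace S] (M : MarkovChain S) (u : ℕ → S) (hu : u 0 = M.init) (n : ℕ) :
    M.runMeasure {r | ∀ j ≤ n, r j = u j} =
      ∏ j ∈ Finset.range n, M.trans (u j) (u (j + 1)) := by
  have key : ∀ n, Kernel.partialTraj (X := fun _ => S) M.stepKernel 0 n (fun _ => M.init)
      {fun i : Finset.Iic n => u i} = ∏ j ∈ Finset.range n, M.trans (u j) (u (j + 1)) := by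
    intro n
    induction n with
    | zero =>
      rw [Kernel.partialTraj_self, Kernel.id_apply, Measure.dirac_apply' _ (measurableSet_singleton _)]
      have : (fun _ => M.init : (i : Finset.Iic 0) → S) ∈ ({fun i : Finset.Iic 0 => u i} : Set ((i : Finset.Iic 0) → S)) := by
        ext ⟨i, hi⟩
        have : i = 0 := by simpa using hi
        subst this; exact hu.symm
      simp [Set.indicator_of_mem this]
    | succ n ih =>
      rw [Kernel.partialTraj_succ_of_le (Nat.zero_le n),
        Kernel.map_apply' _ (by fun_prop) _ (measurableSet_singleton _)]
      have hpre : (IicProdIoc (X := fun _ => S) n (n + 1)) ⁻¹' {fun i : Finset.Iic (n + 1) => u i} =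
          {fun i : Finset.Iic n => u i} ×ˢ
            ((MeasurableEquiv.piSingleton (X := fun _ => S) n) '' {u (n + 1)}) := by
        ext ⟨a, b⟩
        simp only [Set.mem_preimage, Set.mem_singleton_iff, Set.mem_prod, Set.image_singleton]
        constructor
        · intro h
          constructor
          · ext ⟨i, hi⟩
            have h1 := congrFun h ⟨i, by simp at hi ⊢; omega⟩
            have hi' : i ≤ n := by simpa using hi
            simpa [IicProdIoc, hi'] using h1
          · rw [← MeasurableEquiv.symm_apply_eq]
            have h1 := congrFun h ⟨n + 1, by simp⟩
            simpa [IicProdIoc, MeasurableEquiv.piSingleton] using h1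
        · rintro ⟨rfl, h2⟩
          rw [← MeasurableEquiv.symm_apply_eq] at h2
          ext ⟨i, hi⟩
          have hi' : i ≤ n + 1 := by simpa using hi
          by_cases h : i ≤ n
          · simp [IicProdIoc, h]
          · have : i = n + 1 := by omega
            subst this
            simpa [IicProdIoc, MeasurableEquiv.piSingleton] using h2
      have hm : MeasurableSet ((MeasurableEquiv.piSingleton (X := fun _ => S) n) '' {u (n + 1)}) := by
        rw [Set.image_singleton]; exact measurableSet_singleton _
      have : IsMarkovKernel ((M.stepKernel n).map (MeasurableEquiv.piSingleton (X := fun _ => S) n)) :=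
        Kernel.IsMarkovKernel.map _ (by fun_prop)
      rw [hpre, Kernel.comp_apply' _ _ _ ((measurableSet_singleton _).prod hm)]
      have : ∀ h, (Kernel.id ×ₖ (M.stepKernel n).map (MeasurableEquiv.piSingleton (X := fun _ => S) n)) h
          ({fun i : Finset.Iic n => u i} ×ˢ
            ((MeasurableEquiv.piSingleton (X := fun _ => S) n) '' {u (n + 1)})) =
          ({fun i : Finset.Iic n => u i} : Set ((i : Finset.Iic n) → S)).indicator
            (fun _ => M.trans (u n) (u (n + 1))) h := by
        intro h
        rw [Kernel.prod_apply, Measure.prod_prod, Kernel.id_apply,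
          Measure.dirac_apply' _ (measurableSet_singleton _),
          Kernel.map_apply' _ (by fun_prop) _ hm,
          Set.preimage_image_eq _ (MeasurableEquiv.injective _)]
        by_cases hh : h = fun i : Finset.Iic n => u i
        · subst hh
          simp only [Set.mem_singleton_iff, Set.indicator_of_mem, Pi.one_apply, one_mul]
          show (M.trans (u n)).toMeasure {u (n + 1)} = _
          rw [PMF.toMeasure_apply_singleton _ _ (measurableSet_singleton _)]
        · simp [Set.indicator, hh]
      simp_rw [this]
      rw [lintegral_indicator (measurableSet_singleton _), setLIntegral_const, ih,
        Finset.prod_range_succ, mul_comm]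
  rw [← key n, ← Kernel.traj_map_frestrictLe_apply, Measure.map_apply (by fun_prop) (measurableSet_singleton _)]
  rw [runMeasure]
  congr 1
  ext r
  simp [funext_iff, Preorder.frestrictLe]

/-- Under uniformly random inputs, the run generated by a strategy has the same cylinder probabilities
as the Markov chain induced by the strategy. -/
theorem inputMeasure_cone {I O S : Type*} [Fintype I]  (M : MDP S (Finset O))
    (δ : S → Finset (I ⊕ O) → S) (hδ : M.trans = inducedTrans δ) (f : Strategy S (Finset O))
    (u : ℕ → History S) (hu : u 0 = ⟨[], M.init⟩) (n : ℕ) :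
    inputMeasure I {w | ∀ j ≤ n, inputRun δ M.init f w j = u j} =
      ∏ j ∈ Finset.range n, (M.chain f).trans (u j) (u (j + 1)) := by
  have : {w : ℕ → Finset I | ∀ j ≤ n, inputRun δ M.init f w j = u j} =
      Set.pi (Finset.range n) fun j =>
        {i | (u j).snoc (δ (u j).cur (i.disjSum (f (u j)))) = u (j + 1)} := by
    ext w
    simp only [Set.mem_ofPred_eq, Set.mem_pi, Finset.coe_range, Set.mem_Iio]
    constructor
    · intro h j hj
      have h1 := h (j + 1) hj
      rw [inputRun, h j hj.le] at h1
      exact h1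
    · intro h j
      induction j with
      | zero => intro _; rw [hu]; rfl
      | succ j ih =>
        intro hj
        rw [inputRun, ih (by omega)]
        exact h j hj
  rw [this, inputMeasure, Measure.infinitePi_pi _ (fun i _ => Set.Finite.measurableSet (Set.toFinite _))]
  refine Finset.prod_congr rfl fun j _ => ?_
  simp only [MDP.chain, hδ, inducedTrans, PMF.map_comp]
  rw [← PMF.toMeasure_apply_singleton _ (u (j + 1)) (measurableSet_singleton _),
    PMF.toMeasure_map_apply _ _ _ (fun s _ => Set.Finite.measurableSet (Set.toFinite _))
      (measurableSet_singleton _)]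
  rfl

end QualSynth

end

noncomputable section

open MeasureTheory ProbabilityTheory Filter

namespace QualSynth

/-! ### Sequences of independent letters -/

section Letters

variable {X : Type*} [MeasurableSpace X]

/-! The strategy `g` is `f` restarted after every visit to a rejecting state, and its value equals
the conditional value of `f`.

Let `N` be the event that the run of `f` never meets a rejecting state. Almost surely, every
transition from a state that `A_ψ` visits infinitely often is itself taken infinitely often
(`ae_frequently_step`), so the infinitely visited states form an ergodic component. Hence `N` agrees
with `{w | w ⊨ ψ}` up to a null set (`ae_mem_language_iff`, `setOf_sat_ae_eq_noReset`).

Let `h` be the payoff of `g` in the reset MDP, as a function of the input word. On `N` it is the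
payoff of `f`. If a rejecting state is first met at time `t`, the run starts afresh on the suffix
from `t + 1`, which is independent of what came before, and the mean payoff ignores the prefix. This
gives the renewal equation `E[h] = E[payoff of f; N] + (1 - Pr N) E[h]`, that is `Pr N * E[h] =
E[payoff of f; N]` (`measureReal_noReset_mul_integral_restart`). Dividing by `Pr N = Pr(w ⊨ ψ) > 0`
yields the claim.

The value in the reset MDP is an integral over histories. It is carried over to input words by
`runMeasure_eq_map_inputRun`. -/

theorem measurable_suffix (t : ℕ) : Measurable fun w : ℕ → X => suffix w t :=
  measurable_pi_lambda _ fun k => measurable_pi_apply (t + k)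

theorem map_suffix_infinitePi (ν : Measure X) [IsProbabilityMeasure ν] (t : ℕ) :
    (Measure.infinitePi fun _ : ℕ => ν).map (fun w => suffix w t) =
      Measure.infinitePi fun _ : ℕ => ν :=
  Measure.map_infinitePi_infinitePi_of_inj (P := fun _ : ℕ => ν) (f := fun k => t + k)
    (add_right_injective t)

variable [Finite X] [MeasurableSingletonClass X]

/-- A function of the first `t` letters is measurable with respect to them. -/
theorem measurable_iSup_comap_of_dependsOn {Y : Type*} [MeasurableSpace Y] {F : (ℕ → X) → Y}
    {t : ℕ} (hF : DependsOn F (Set.Iio t)) :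
    Measurable[⨆ i ∈ Set.Iio t, MeasurableSpace.comap (fun w : ℕ → X => w i) inferInstance] F := by
  rcases isEmpty_or_nonempty X with hX | ⟨⟨x₀⟩⟩
  · have : IsEmpty (ℕ → X) := ⟨fun w => hX.false (w 0)⟩
    intro s _
    rw [Set.eq_empty_of_isEmpty (F ⁻¹' s)]
    exact @MeasurableSet.empty _ (_)
  · let G : (Fin t → X) → Y := fun a => F fun j => if h : j < t then a ⟨j, h⟩ else x₀
    have hG : F = G ∘ fun w (j : Fin t) => w j := by
      funext w
      exact hF fun j hj => by simp [Set.mem_Iio.1 hj]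
    rw [hG]
    refine (Measurable.of_discrete (f := G)).comp ?_
    refine @measurable_pi_lambda _ _ _ (_) _ _ fun j => ?_
    exact (comap_measurable (fun w : ℕ → X => w j)).mono
      (le_iSup₂_of_le (j : ℕ) (Set.mem_Iio.2 j.2) le_rfl) le_rfl

theorem measurable_of_dependsOn {Y : Type*} [MeasurableSpace Y] {F : (ℕ → X) → Y}
    {t : ℕ} (hF : DependsOn F (Set.Iio t)) : Measurable F :=
  (measurable_iSup_comap_of_dependsOn hF).mono
    (iSup₂_le fun i _ => (measurable_pi_apply i).comap_le) le_rfl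

theorem measurableSet_of_dependsOn {E : Set (ℕ → X)} {t : ℕ}
    (hE : DependsOn (· ∈ E) (Set.Iio t)) : MeasurableSet E :=
  measurableSet_setOfPred.2 (measurable_of_dependsOn hE)

variable (ν : Measure X) [IsProbabilityMeasure ν]

/-- The letters from time `t` on are independent of the first `t` letters. -/
theorem map_suffix_restrict_infinitePi {E : Set (ℕ → X)} {t : ℕ}
    (hE : DependsOn (· ∈ E) (Set.Iio t)) :
    ((Measure.infinitePi fun _ : ℕ => ν).restrict E).map (fun w => suffix w t) =
      (Measure.infinitePi fun _ : ℕ => ν) E • Measure.infinitePi fun _ : ℕ => ν := by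
  ext B hB
  rw [Measure.map_apply (measurable_suffix t) hB,
    Measure.restrict_apply (measurable_suffix t hB), Measure.smul_apply, smul_eq_mul]
  have hind : iIndep (fun i : ℕ => MeasurableSpace.comap (fun w : ℕ → X => w i) inferInstance)
      (Measure.infinitePi fun _ : ℕ => ν) :=
    (iIndepFun_infinitePi (P := fun _ : ℕ => ν) (X := fun _ x => x) fun _ => measurable_id)
  have h := indep_iSup_of_disjoint (fun i => (measurable_pi_apply i).comap_le) hind
    (S := Set.Iio t) (T := Set.Ici t) (Set.disjoint_left.2 fun i hi hi' => by
      simp only [Set.mem_Iio, Set.mem_Ici] at hi hi'; omega)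
  have hB' : MeasurableSet[⨆ i ∈ Set.Ici t,
      MeasurableSpace.comap (fun w : ℕ → X => w i) inferInstance]
      ((fun w : ℕ → X => suffix w t) ⁻¹' B) := by
    refine @measurable_pi_lambda _ _ _ (_) _ _ (fun k => ?_) B hB
    exact (comap_measurable (fun w : ℕ → X => w (t + k))).mono
      (le_iSup₂_of_le (t + k) (Set.mem_Ici.2 (Nat.le_add_right t k)) le_rfl) le_rfl
  have hE' := (@measurableSet_setOfPred _ (_) _).2 (measurable_iSup_comap_of_dependsOn hE)
  rw [Set.inter_comm, (Indep_iff _ _ _).1 h E _ hE' hB',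
    ← Measure.map_apply (measurable_suffix t) hB, map_suffix_infinitePi]

theorem infinitePi_inter_preimage_suffix {E B : Set (ℕ → X)} {t : ℕ}
    (hE : DependsOn (· ∈ E) (Set.Iio t)) (hB : MeasurableSet B) :
    (Measure.infinitePi fun _ : ℕ => ν) (E ∩ (fun w => suffix w t) ⁻¹' B) =
      (Measure.infinitePi fun _ : ℕ => ν) E * (Measure.infinitePi fun _ : ℕ => ν) B := by
  have h := congrArg (fun m => m B) (map_suffix_restrict_infinitePi ν hE)
  simp only [Measure.map_apply (measurable_suffix t) hB,
    Measure.restrict_apply (measurable_suffix t hB), Measure.smul_apply, smul_eq_mul] at h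
  rw [Set.inter_comm, h]

theorem setIntegral_comp_suffix {E : Set (ℕ → X)} {t : ℕ}
    (hE : DependsOn (· ∈ E) (Set.Iio t)) {h : (ℕ → X) → ℝ} (hh : Measurable h) :
    ∫ w in E, h (suffix w t) ∂(Measure.infinitePi fun _ : ℕ => ν) =
      (Measure.infinitePi fun _ : ℕ => ν).real E *
        ∫ w, h w ∂(Measure.infinitePi fun _ : ℕ => ν) := by
  rw [← integral_map (φ := fun w => suffix w t) (measurable_suffix t).aemeasurable
    hh.aestronglyMeasurable, map_suffix_restrict_infinitePi ν hE, integral_smul_measure]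
  rfl

end Letters

/-! ### Mean payoffs -/

/-- The mean payoff of a sequence of rewards. -/
def meanPayoff (c : ℕ → ℝ) : ℝ :=
  liminf (fun m : ℕ => (1 / (m : ℝ)) * ∑ j ∈ Finset.range (m + 1), c j) atTop

/-- There are `m + 1` summands but the divisor is `m`, and `(m + 1) / m ≤ 2` for `m ≥ 1`. At `m = 0`
the convention `1 / 0 = 0` makes the average vanish. -/
theorem abs_average_le {c : ℕ → ℝ} {B : ℝ} (hc : ∀ j, |c j| ≤ B) (m : ℕ) :
    |(1 / (m : ℝ)) * ∑ j ∈ Finset.range (m + 1), c j| ≤ 2 * B := by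
  have hB : 0 ≤ B := (abs_nonneg _).trans (hc 0)
  have hs : |∑ j ∈ Finset.range (m + 1), c j| ≤ (m + 1) * B := by
    refine (Finset.abs_sum_le_sum_abs _ _).trans ((Finset.sum_le_sum fun j _ => hc j).trans ?_)
    simp
  rcases Nat.eq_zero_or_pos m with rfl | hm
  · simpa using hB
  · have hm' : (1 : ℝ) ≤ m := by exact_mod_cast hm
    rw [abs_mul, abs_of_nonneg (by positivity), one_div, inv_mul_le_iff₀ (by positivity)]
    nlinarith

theorem isBoundedUnder_average {c : ℕ → ℝ} {B : ℝ} (hc : ∀ j, |c j| ≤ B) :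
    IsBoundedUnder (· ≤ ·) atTop
        (fun m : ℕ => (1 / (m : ℝ)) * ∑ j ∈ Finset.range (m + 1), c j) ∧
      IsBoundedUnder (· ≥ ·) atTop
        (fun m : ℕ => (1 / (m : ℝ)) * ∑ j ∈ Finset.range (m + 1), c j) :=
  ⟨isBoundedUnder_of ⟨2 * B, fun m => (abs_le.1 (abs_average_le hc m)).2⟩,
    isBoundedUnder_of ⟨-(2 * B), fun m => (abs_le.1 (abs_average_le hc m)).1⟩⟩

theorem abs_meanPayoff_le {c : ℕ → ℝ} {B : ℝ} (hc : ∀ j, |c j| ≤ B) :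
    |meanPayoff c| ≤ 2 * B := by
  obtain ⟨h₁, h₂⟩ := isBoundedUnder_average hc
  refine abs_le.2 ⟨?_, ?_⟩
  · exact le_liminf_of_le h₁.isCoboundedUnder_ge
      (Eventually.of_forall fun m => (abs_le.1 (abs_average_le hc m)).1)
  · exact liminf_le_of_le h₂ fun b hb => by
      obtain ⟨m, hm⟩ := hb.exists
      exact hm.trans (abs_le.1 (abs_average_le hc m)).2

theorem liminf_eq_of_tendsto_sub {u v : ℕ → ℝ} (hu : IsBoundedUnder (· ≤ ·) atTop u)
    (hu' : IsBoundedUnder (· ≥ ·) atTop u)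
    (h : Tendsto (fun m => v m - u m) atTop (nhds 0)) :
    liminf v atTop = liminf u atTop := by
  have hv : v = (fun m => v m - u m) + u := by funext m; simp
  have e₁ := h.isBoundedUnder_le
  have e₂ := h.isBoundedUnder_ge
  refine le_antisymm ?_ ?_
  · have := liminf_add_le e₂ e₁ hu' hu.isCoboundedUnder_ge
    rwa [← hv, h.limsup_eq, zero_add] at this
  · have := le_liminf_add e₂ e₁ hu' hu.isCoboundedUnder_ge
    rwa [← hv, h.liminf_eq, zero_add] at this

/-- The mean payoff of a bounded sequence does not depend on a finite prefix. -/
theorem meanPayoff_suffix {c : ℕ → ℝ} {B : ℝ} (hc : ∀ j, |c j| ≤ B) (t : ℕ) :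
    meanPayoff (suffix c t) = meanPayoff c := by
  obtain ⟨h₁, h₂⟩ := isBoundedUnder_average hc
  refine liminf_eq_of_tendsto_sub h₁ h₂ ?_
  -- The two windows of length `m + 1` overlap except for `t` terms at each end, so the difference
  -- of sums is bounded uniformly in `m` and vanishes after division by `m`.
  have hdiff : ∀ m : ℕ, ∑ j ∈ Finset.range (m + 1), suffix c t j
      - ∑ j ∈ Finset.range (m + 1), c j =
      ∑ j ∈ Finset.range t, c (m + 1 + j) - ∑ j ∈ Finset.range t, c j := by
    intro m
    have e₁ := Finset.sum_range_add c t (m + 1)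
    have e₂ := Finset.sum_range_add c (m + 1) t
    rw [add_comm t (m + 1)] at e₁
    simp only [suffix]
    linarith
  have hb : ∀ m : ℕ, |∑ j ∈ Finset.range t, c (m + 1 + j) - ∑ j ∈ Finset.range t, c j|
      ≤ 2 * (t * B) := by
    intro m
    have hs : ∀ d : ℕ → ℝ, (∀ j, |d j| ≤ B) → |∑ j ∈ Finset.range t, d j| ≤ t * B := by
      intro d hd
      refine (Finset.abs_sum_le_sum_abs _ _).trans ((Finset.sum_le_sum fun j _ => hd j).trans ?_)
      simp
    refine (abs_sub _ _).trans ?_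
    have := hs (fun j => c (m + 1 + j)) fun j => hc _
    have := hs c hc
    linarith
  have hz : Tendsto (fun m : ℕ => (1 / (m : ℝ)) * (2 * (t * B))) atTop (nhds 0) := by
    simpa using tendsto_one_div_atTop_nhds_zero_nat.mul_const (2 * (t * B))
  refine squeeze_zero_norm (fun m => ?_) hz
  rw [← mul_sub, hdiff, norm_mul, Real.norm_eq_abs, Real.norm_eq_abs,
    abs_of_nonneg (by positivity : (0 : ℝ) ≤ 1 / (m : ℝ))]
  exact mul_le_mul_of_nonneg_left (hb m) (by positivity)

theorem measurable_meanPayoff : Measurable meanPayoff := by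
  unfold meanPayoff
  refine Measurable.liminf fun m => ?_
  fun_prop

/-! ### Runs on independent letters -/

section Runs

/-- The run of a transition function from a given state. -/
def runFrom {X P : Type*} (δ : P → X → P) (p : P) (w : ℕ → X) : ℕ → P
  | 0 => p
  | j + 1 => δ (runFrom δ p w j) (w j)

theorem DPW.run_eq_runFrom {X P : Type*} (A : DPW X P) (w : ℕ → X) :
    A.run w = runFrom A.step A.init w := by
  funext j
  induction j with
  | zero => rfl
  | succ j ih => rw [DPW.run, runFrom, ih]

theorem runFrom_add {X P : Type*} (δ : P → X → P) (p : P) (w : ℕ → X) (s t : ℕ) :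
    runFrom δ p w (s + t) = runFrom δ (runFrom δ p w s) (suffix w s) t := by
  induction t with
  | zero => rfl
  | succ t ih => rw [← add_assoc, runFrom, runFrom, ih]; rfl

theorem dependsOn_runFrom {X P : Type*} (δ : P → X → P) (p : P) (j : ℕ) :
    DependsOn (fun w => runFrom δ p w j) (Set.Iio j) := by
  induction j with
  | zero => intro w w' _; rfl
  | succ j ih =>
    intro w w' h
    simp only [runFrom]
    rw [h j (Set.mem_Iio.2 j.lt_succ_self)]
    exact congrArg (fun q => δ q (w' j))
      (ih fun i hi => h i (Set.mem_Iio.2 (lt_trans hi j.lt_succ_self)))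

/-- The words on which the run from `p` is in `q` infinitely often, without ever reading `x`
in `q`. -/
def avoiding {X P : Type*} (δ : P → X → P) (q : P) (x : X) (p : P) : Set (ℕ → X) :=
  {w | (∃ᶠ j in atTop, runFrom δ p w j = q) ∧ ∀ j, runFrom δ p w j = q → w j ≠ x}

theorem suffix_mem_avoiding {X P : Type*} {δ : P → X → P} {q : P} {x : X} {p : P} {w : ℕ → X}
    (hw : w ∈ avoiding δ q x p) (t : ℕ) :
    suffix w t ∈ avoiding δ q x (runFrom δ p w t) := by
  obtain ⟨h₁, h₂⟩ := hw
  refine ⟨frequently_atTop.2 fun a => ?_, fun j hj => ?_⟩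
  · obtain ⟨b, hb, hb'⟩ := frequently_atTop.1 h₁ (t + a)
    refine ⟨b - t, by omega, ?_⟩
    rw [← runFrom_add, Nat.add_sub_cancel' (by omega), hb']
  · rw [← runFrom_add] at hj
    exact h₂ _ hj

variable {X : Type*} [MeasurableSpace X] [Finite X] [MeasurableSingletonClass X] {P : Type*}

theorem measurableSet_runFrom_eq (δ : P → X → P) (p q : P) (j : ℕ) :
    MeasurableSet {w | runFrom δ p w j = q} :=
  measurableSet_of_dependsOn (t := j) fun w w' h => by
    simp only [Set.mem_ofPred_eq]
    rw [show runFrom δ p w j = runFrom δ p w' j from dependsOn_runFrom δ p j h]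

theorem measurableSet_avoiding (δ : P → X → P) (q : P) (x : X) (p : P) :
    MeasurableSet (avoiding δ q x p) := by
  have : avoiding δ q x p = (⋂ a : ℕ, ⋃ b : ℕ, ⋃ _ : a ≤ b, {w | runFrom δ p w b = q}) ∩
      ⋂ j : ℕ, ({w | runFrom δ p w j = q}ᶜ ∪ {w | w j = x}ᶜ) := by
    ext w
    simp [avoiding, frequently_atTop, imp_iff_not_or]
  rw [this]
  refine MeasurableSet.inter ?_ ?_
  · exact MeasurableSet.iInter fun a => MeasurableSet.iUnion fun b => MeasurableSet.iUnion fun _ =>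
      measurableSet_runFrom_eq δ p q b
  · exact MeasurableSet.iInter fun j => (measurableSet_runFrom_eq δ p q j).compl.union
      (measurableSet_eq_fun (measurable_pi_apply j) measurable_const).compl

variable (ν : Measure X) [IsProbabilityMeasure ν]

/-- Split by the time `t` of the first visit to `q`. From then on the word avoids `x` starting in
`q`, independently of the first `t` letters, and the first-visit events are disjoint, so their
probabilities sum to at most `1`. -/
theorem measure_avoiding_le (δ : P → X → P) (q : P) (x : X) (p : P) :
    (Measure.infinitePi fun _ : ℕ => ν) (avoiding δ q x p) ≤
      (Measure.infinitePi fun _ : ℕ => ν) (avoiding δ q x q) := by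
  let E : ℕ → Set (ℕ → X) := fun t =>
    {w | runFrom δ p w t = q ∧ ∀ j < t, runFrom δ p w j ≠ q}
  have hE : ∀ t, DependsOn (· ∈ E t) (Set.Iio t) := by
    intro t w w' h
    have e : ∀ j ≤ t, runFrom δ p w j = runFrom δ p w' j := fun j hj =>
      dependsOn_runFrom δ p j fun i hi => h i (Set.mem_Iio.2 (lt_of_lt_of_le hi hj))
    simp only [E, Set.mem_ofPred_eq, e t le_rfl]
    refine propext (and_congr_right fun _ => forall₂_congr fun j hj => ?_)
    rw [e j hj.le]
  have hdisj : Pairwise (Function.onFun Disjoint E) := by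
    intro s t hst
    refine Set.disjoint_left.2 fun w hs ht => ?_
    rcases lt_or_gt_of_ne hst with h | h
    · exact ht.2 s h hs.1
    · exact hs.2 t h ht.1
  have hsub : avoiding δ q x p ⊆
      ⋃ t, E t ∩ (fun w => suffix w t) ⁻¹' avoiding δ q x q := by
    classical
    intro w hw
    have hex : ∃ t, runFrom δ p w t = q := hw.1.exists
    refine Set.mem_iUnion.2 ⟨Nat.find hex, ⟨Nat.find_spec hex, fun j hj => Nat.find_min hex hj⟩, ?_⟩
    have := suffix_mem_avoiding hw (Nat.find hex)
    rwa [Nat.find_spec hex] at this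
  calc (Measure.infinitePi fun _ : ℕ => ν) (avoiding δ q x p)
      ≤ ∑' t, (Measure.infinitePi fun _ : ℕ => ν)
          (E t ∩ (fun w => suffix w t) ⁻¹' avoiding δ q x q) :=
        (measure_mono hsub).trans (measure_iUnion_le _)
    _ = (∑' t, (Measure.infinitePi fun _ : ℕ => ν) (E t)) *
          (Measure.infinitePi fun _ : ℕ => ν) (avoiding δ q x q) := by
        rw [← ENNReal.tsum_mul_right]
        exact tsum_congr fun t =>
          infinitePi_inter_preimage_suffix ν (hE t) (measurableSet_avoiding δ q x q)
    _ ≤ 1 * (Measure.infinitePi fun _ : ℕ => ν) (avoiding δ q x q) := by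
        gcongr
        rw [← measure_iUnion hdisj fun t => measurableSet_of_dependsOn (hE t)]
        exact prob_le_one
    _ = _ := one_mul _

/-- Let `α` be the probability of avoiding from `q`. The first letter read in `q` is not `x`, and
whatever state it leads to, the remaining probability is at most `α`. Thus `α ≤ (1 - ν {x}) * α`,
which forces `α = 0`. -/
theorem measure_avoiding (δ : P → X → P) (q : P) {x : X} (hx : ν {x} ≠ 0) (p : P) :
    (Measure.infinitePi fun _ : ℕ => ν) (avoiding δ q x p) = 0 := by
  have : Fintype X := Fintype.ofFinite X
  set μ := Measure.infinitePi fun _ : ℕ => ν with hμ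
  refine le_antisymm ((measure_avoiding_le ν δ q x p).trans_eq ?_) bot_le
  rw [← hμ]
  have hE : ∀ a : X, DependsOn (· ∈ {w : ℕ → X | w 0 = a}) (Set.Iio 1) := by
    intro a w w' h
    simp only [Set.mem_ofPred_eq, h 0 (Set.mem_Iio.2 one_pos)]
  have hν : ∀ a : X, μ {w : ℕ → X | w 0 = a} = ν {a} := by
    intro a
    rw [← Measure.infinitePi_map_eval (fun _ : ℕ => ν) 0,
      Measure.map_apply (measurable_pi_apply 0) (measurableSet_singleton a)]
    rfl
  classical
  have hsub : avoiding δ q x q ⊆ ⋃ a ∈ Finset.univ.erase x,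
      {w : ℕ → X | w 0 = a} ∩ (fun w => suffix w 1) ⁻¹' avoiding δ q x (δ q a) := by
    intro w hw
    refine Set.mem_biUnion (x := w 0) ?_ ⟨rfl, suffix_mem_avoiding hw 1⟩
    exact Finset.mem_coe.2 (Finset.mem_erase.2 ⟨hw.2 0 rfl, Finset.mem_univ _⟩)
  have hle : μ (avoiding δ q x q) ≤
      (∑ a ∈ Finset.univ.erase x, ν {a}) * μ (avoiding δ q x q) := by
    refine (measure_mono hsub).trans ((measure_biUnion_finset_le _ _).trans ?_)
    rw [Finset.sum_mul]
    refine Finset.sum_le_sum fun a _ => ?_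
    rw [hμ, infinitePi_inter_preimage_suffix ν (hE a) (measurableSet_avoiding δ q x _), ← hμ, hν]
    exact mul_le_mul_right (measure_avoiding_le ν δ q x _) _
  have hsum : (∑ a ∈ Finset.univ.erase x, ν {a}) < 1 := by
    have h1 : ∑ a : X, ν {a} = 1 := by
      rw [sum_measure_singleton, Finset.coe_univ, measure_univ]
    rw [← Finset.add_sum_erase _ _ (Finset.mem_univ x)] at h1
    rw [← h1]
    have hfin : ∑ a ∈ Finset.univ.erase x, ν {a} ≠ ⊤ :=
      ne_top_of_le_ne_top ENNReal.one_ne_top (h1 ▸ le_add_self)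
    rw [add_comm]
    exact ENNReal.lt_add_right hfin hx
  by_contra h0
  have := ENNReal.mul_lt_mul_left h0 (measure_ne_top μ _) hsum
  rw [one_mul] at this
  exact absurd hle (not_le.2 (by simpa [mul_comm] using this))

/-- Almost surely, every transition of positive probability from a state that is visited infinitely
often is taken infinitely often. -/
theorem ae_frequently_step [Finite P] (hν : ∀ x, ν {x} ≠ 0) (δ : P → X → P) (p : P) :
    ∀ᵐ w ∂(Measure.infinitePi fun _ : ℕ => ν), ∀ q x,
      (∃ᶠ j in atTop, runFrom δ p w j = q) → ∃ᶠ j in atTop, runFrom δ p w j = δ q x := by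
  -- If `q` recurs but `δ q x` does not, then from some time on `x` is never read in `q`, so some
  -- suffix lies in an avoiding set. Only countably many null sets have to be excluded.
  have h : ∀ᵐ w ∂(Measure.infinitePi fun _ : ℕ => ν), ∀ (q : P) (x : X) (t : ℕ) (p' : P),
      suffix w t ∉ avoiding δ q x p' := by
    simp only [ae_all_iff]
    intro q x t p'
    have h0 := measure_avoiding ν δ q (hν x) p'
    rw [← map_suffix_infinitePi ν t, Measure.map_apply (measurable_suffix t)
      (measurableSet_avoiding δ q x p')] at h0
    exact measure_eq_zero_iff_ae_notMem.1 h0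
  filter_upwards [h] with w hw q x hq
  refine frequently_atTop.2 fun a => ?_
  by_contra! hcon
  refine hw q x a (runFrom δ p w a) ⟨frequently_atTop.2 fun b => ?_, fun j hj hx => ?_⟩
  · obtain ⟨c, hc, hc'⟩ := frequently_atTop.1 hq (a + b)
    refine ⟨c - a, by omega, ?_⟩
    rw [← runFrom_add, Nat.add_sub_cancel' (by omega), hc']
  · rw [← runFrom_add] at hj
    refine hcon (a + j + 1) (by omega) ?_
    rw [runFrom, hj]
    exact congrArg (δ q) hx

end Runs

/-! ### Acceptance of random words -/

theorem exists_frequently_eq {Q : Type*} [Finite Q] (r : ℕ → Q) :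
    ∃ q, ∃ᶠ j in atTop, r j = q := by
  by_contra! h
  have : ∀ᶠ j in atTop, ∀ q, r j ≠ q := eventually_all.2 h
  obtain ⟨j, hj⟩ := this.exists
  exact hj _ rfl

theorem eventually_mem_infStates {Q : Type*} [Finite Q] (r : ℕ → Q) :
    ∀ᶠ j in atTop, r j ∈ infStates r := by
  have : ∀ᶠ j in atTop, ∀ q, q ∉ infStates r → r j ≠ q :=
    eventually_all.2 fun q => by
      by_cases hq : q ∈ infStates r
      · exact Eventually.of_forall fun j h => absurd hq h
      · exact (not_frequently.1 hq).mono fun j h _ => h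
  filter_upwards [this] with j hj
  by_contra h
  exact hj _ h rfl

/-- Every letter has positive mass, so positive probability just means an edge of the automaton. -/
theorem inputChain_trans_pos {I Q : Type*} [Fintype I] (A : DPW (Finset I) Q) (x y : Q) :
    0 < (inputChain A).trans x y ↔ ∃ i, A.step x i = y := by
  rw [PMF.apply_pos_iff, inputChain, PMF.mem_support_map_iff]
  simp

theorem MarkovChain.IsErgodicComponent.step_mem {I Q : Type*} [Fintype I] {A : DPW (Finset I) Q}
    {C : Set Q} (hC : (inputChain A).IsErgodicComponent C) {q : Q} (hq : q ∈ C) (i : Finset I) :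
    A.step q i ∈ C := by
  by_contra h
  exact ((inputChain_trans_pos A _ _).2 ⟨i, rfl⟩).ne' (hC.2.2 q hq _ h)

/-- Ergodic components are minimal among closed sets: all of `C` is reachable from `q`, and paths
from `q` cannot leave `D`. -/
theorem MarkovChain.IsErgodicComponent.subset_of_closed {I Q : Type*} [Fintype I]
    {A : DPW (Finset I) Q} {C D : Set Q} (hC : (inputChain A).IsErgodicComponent C)
    (hD : ∀ q ∈ D, ∀ i, A.step q i ∈ D) {q : Q} (hqC : q ∈ C) (hqD : q ∈ D) : C ⊆ D := by
  intro t ht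
  have h := hC.2.1 q hqC t ht
  induction h with
  | refl => exact hqD
  | tail _ hxy ih =>
    obtain ⟨i, rfl⟩ := (inputChain_trans_pos A _ _).1 hxy.2.2
    exact hD _ (ih hxy.1) i

/-- After some time the run stays among its recurrent states, so the segment between a visit to `s`
and a later visit to `t` is a path inside the set. -/
theorem isErgodicComponent_infStates {I Q : Type*} [Fintype I] [Finite Q] (A : DPW (Finset I) Q)
    {w : ℕ → Finset I}
    (hw : ∀ q ∈ infStates (A.run w), ∀ i, A.step q i ∈ infStates (A.run w)) :
    (inputChain A).IsErgodicComponent (infStates (A.run w)) := by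
  refine ⟨exists_frequently_eq _, fun s hs t ht => ?_, fun s hs t ht => ?_⟩
  · obtain ⟨N, hN⟩ := eventually_atTop.1 (eventually_mem_infStates (A.run w))
    obtain ⟨a, ha, rfl⟩ := frequently_atTop.1 hs N
    obtain ⟨b, hb, rfl⟩ := frequently_atTop.1 ht a
    clear hs ht
    induction b, hb using Nat.le_induction with
    | base => exact .refl
    | succ b hb ih =>
      exact ih.tail ⟨hN b (ha.trans hb), hN (b + 1) (ha.trans (hb.trans b.le_succ)),
        (inputChain_trans_pos A _ _).2 ⟨w b, rfl⟩⟩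
  · by_contra h
    obtain ⟨i, rfl⟩ := (inputChain_trans_pos A _ _).1 (pos_iff_ne_zero.2 h)
    exact ht (hw s hs i)

/-- The deterministic half of the acceptance criterion. A component once entered is never left and
contains no smaller closed set, so a rejecting one that is visited is exactly the set of recurrent
states. Conversely, that set is itself an ergodic component, rejecting when its maximal rank is odd.
-/
theorem mem_language_iff_of_closed {I Q : Type*} [Fintype I] [Finite Q] (A : DPW (Finset I) Q)
    {w : ℕ → Finset I}
    (hw : ∀ q ∈ infStates (A.run w), ∀ i, A.step q i ∈ infStates (A.run w)) :
    w ∈ A.language ↔ ∀ j, ¬ ∃ C, IsRejectingComponent A C ∧ A.run w j ∈ C := by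
  have hE := isErgodicComponent_infStates A hw
  constructor
  · rintro ⟨m, hm, hme⟩ j ⟨C, ⟨hC, m', hm', hmo⟩, hj⟩
    have hstay : ∀ k ≥ j, A.run w k ∈ C := by
      intro k hk
      induction k, hk using Nat.le_induction with
      | base => exact hj
      | succ k _ ih => exact hC.step_mem ih (w k)
    have hsub : infStates (A.run w) ⊆ C := by
      intro q hq
      obtain ⟨k, hk, rfl⟩ := frequently_atTop.1 hq j
      exact hstay k hk
    obtain ⟨q, hq⟩ := hE.1
    have heq : infStates (A.run w) = C :=
      hsub.antisymm (hC.subset_of_closed hw (hsub hq) hq)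
    rw [heq] at hm
    exact (Nat.not_even_iff_odd.2 hmo) (hm.unique hm' ▸ hme)
  · intro h
    obtain ⟨q, hq, hmax⟩ := (Set.toFinite (infStates (A.run w))).exists_maximalFor A.rank _ hE.1
    have hm : IsGreatest (A.rank '' infStates (A.run w)) (A.rank q) := by
      refine ⟨⟨q, hq, rfl⟩, ?_⟩
      rintro _ ⟨p, hp, rfl⟩
      exact (le_total (A.rank p) (A.rank q)).elim id fun h' => hmax hp h'
    refine ⟨_, hm, ?_⟩
    by_contra hodd
    obtain ⟨j, hj⟩ := Frequently.exists hq
    exact h j ⟨_, ⟨hE, _, hm, Nat.not_even_iff_odd.1 hodd⟩, hj ▸ hq⟩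

instance (I : Type*) [Fintype I] : IsProbabilityMeasure (inputMeasure I) := by
  unfold inputMeasure; infer_instance

/-- Almost surely, a word is accepted if and only if its run visits no rejecting ergodic
component. -/
theorem ae_mem_language_iff {I Q : Type*} [Fintype I] [Finite Q] (A : DPW (Finset I) Q) :
    ∀ᵐ w ∂inputMeasure I,
      w ∈ A.language ↔ ∀ j, ¬ ∃ C, IsRejectingComponent A C ∧ A.run w j ∈ C := by
  have hpos : ∀ i : Finset I, (PMF.uniformOfFintype (Finset I)).toMeasure {i} ≠ 0 := by
    intro i
    rw [PMF.toMeasure_apply_singleton _ _ (measurableSet_singleton _)]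
    simp
  filter_upwards [ae_frequently_step _ hpos A.step A.init] with w hw
  refine mem_language_iff_of_closed A fun q hq i => ?_
  rw [A.run_eq_runFrom] at hq ⊢
  exact hw q i hq

/-! ### Random runs as functions of the input word -/

section InputRun

variable {I O S : Type*}

theorem dependsOn_inputRun (δ : S → Finset (I ⊕ O) → S) (s₀ : S) (f : Strategy S (Finset O))
    (j : ℕ) : DependsOn (fun w => inputRun δ s₀ f w j) (Set.Iio j) := by
  induction j with
  | zero => intro w w' _; rfl
  | succ j ih =>
    intro w w' h
    have e : inputRun δ s₀ f w j = inputRun δ s₀ f w' j :=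
      ih fun i hi => h i (Set.mem_Iio.2 (lt_trans hi j.lt_succ_self))
    simp only [inputRun, e, h j (Set.mem_Iio.2 j.lt_succ_self)]

theorem measurable_inputRun [Fintype I] (δ : S → Finset (I ⊕ O) → S) (s₀ : S)
    (f : Strategy S (Finset O)) : Measurable fun w => inputRun δ s₀ f w :=
  measurable_pi_lambda _ fun j => measurable_of_dependsOn (dependsOn_inputRun δ s₀ f j)

instance {S : Type*} [Countable S] [MeasurableSpace S] [DiscreteMeasurableSpace S]
    (M : MarkovChain S) : IsProbabilityMeasure M.runMeasure := by
  unfold MarkovChain.runMeasure; infer_instance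

/-- The random run of the chain induced by a strategy is the run generated by the strategy on a
random input word. -/
theorem runMeasure_eq_map_inputRun [Fintype I] [Countable S] (M : MDP S (Finset O))
    (δ : S → Finset (I ⊕ O) → S) (hδ : M.trans = inducedTrans δ) (f : Strategy S (Finset O)) :
    (M.chain f).runMeasure = (inputMeasure I).map fun w => inputRun δ M.init f w := by
  have hm := measurable_inputRun δ M.init f
  set ρ := (inputMeasure I).map fun w => inputRun δ M.init f w with hρ
  have : IsProbabilityMeasure ρ := Measure.isProbabilityMeasure_map hm.aemeasurable
  have hcone : ∀ (u : ℕ → History S) (n : ℕ),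
      MeasurableSet {r : ℕ → History S | ∀ j ≤ n, r j = u j} := by
    intro u n
    have : {r : ℕ → History S | ∀ j ≤ n, r j = u j} = ⋂ j, ⋂ _ : j ≤ n, {r | r j = u j} := by
      ext r; simp
    rw [this]
    exact MeasurableSet.iInter fun j => MeasurableSet.iInter fun _ =>
      measurableSet_eq_fun (measurable_pi_apply j) measurable_const
  -- The cone formulas only cover sequences that begin in the initial state. All other cones are
  -- null for both measures.
  have hnull : ∀ (σ : Measure (ℕ → History S)) [IsProbabilityMeasure σ],
      σ {r | ∀ j ≤ 0, r j = (M.chain f).init} = 1 → ∀ (u : ℕ → History S) (n : ℕ),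
      u 0 ≠ (M.chain f).init → σ {r | ∀ j ≤ n, r j = u j} = 0 := by
    intro σ _ h1 u n hu
    refine measure_mono_null (fun r hr => ?_)
      ((prob_compl_eq_zero_iff (hcone (fun _ => (M.chain f).init) 0)).2 h1)
    exact fun h => hu ((hr 0 n.zero_le).symm.trans (h 0 le_rfl))
  have hρcone : ∀ (u : ℕ → History S) (_ : u 0 = (M.chain f).init) (n : ℕ),
      ρ {r | ∀ j ≤ n, r j = u j} =
        ∏ j ∈ Finset.range n, (M.chain f).trans (u j) (u (j + 1)) := by
    intro u hu n
    rw [hρ, Measure.map_apply hm (hcone u n)]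
    exact inputMeasure_cone M δ hδ f u hu n
  have hall : ∀ (u : ℕ → History S) (n : ℕ),
      (M.chain f).runMeasure {r | ∀ j ≤ n, r j = u j} = ρ {r | ∀ j ≤ n, r j = u j} := by
    intro u n
    by_cases hu : u 0 = (M.chain f).init
    · rw [hρcone u hu, MarkovChain.runMeasure_cone _ u hu]
    · rw [hnull ρ (by simpa using hρcone (fun _ => (M.chain f).init) rfl 0) u n hu,
        hnull _ (by simpa using
          (M.chain f).runMeasure_cone (fun _ => (M.chain f).init) rfl 0) u n hu]
  -- Equality follows from uniqueness of projective limits: it suffices to compare marginals on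
  -- initial segments, and these live on a countable space, hence are determined by singletons,
  -- whose preimages are cones.
  have hfam : IsProjectiveMeasureFamily
      (α := fun _ : ℕ => History S) (fun J => ρ.map J.restrict) := by
    intro J K hKJ
    beta_reduce
    rw [Measure.map_map (Finset.measurable_restrict₂ hKJ) (Finset.measurable_restrict J)]
    rfl
  have hlim : IsProjectiveLimit (M.chain f).runMeasure
      (α := fun _ : ℕ => History S) (fun J => ρ.map J.restrict) := by
    rw [isProjectiveLimit_nat_iff hfam]
    intro n
    refine Measure.ext_of_singleton fun a => ?_
    rw [Measure.map_apply (Preorder.measurable_frestrictLe n) (measurableSet_singleton a),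
      Measure.map_apply (Finset.measurable_restrict _) (measurableSet_singleton a)]
    have hset : (Preorder.frestrictLe (π := fun _ : ℕ => History S) n) ⁻¹' {a} =
        {r : ℕ → History S | ∀ j ≤ n, r j =
          (fun k => if h : k ≤ n then a ⟨k, Finset.mem_Iic.2 h⟩ else (M.chain f).init) j} := by
      ext r
      simp only [Set.mem_preimage, Set.mem_singleton_iff, Set.mem_ofPred_eq, funext_iff,
        Subtype.forall, Finset.mem_Iic]
      refine forall₂_congr fun j hj => ?_
      simp [Preorder.frestrictLe, hj]
    have hset' := hset
    rw [Preorder.frestrictLe] at hset'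
    rw [hset, hset', hall]
  exact hlim.unique fun J => rfl

end InputRun

/-! ### Restarting a strategy -/

section Restart

variable {I O S : Type*}

open Classical in
/-- The part of a history after the last visit, before the current state, to a state of `R`. -/
def History.sinceReset (R : S → Prop) (u : History S) : History S :=
  ⟨u.past.rtakeWhile fun s => ¬ R s, u.cur⟩

/-- A current state in `R` does not truncate its own history. Truncation happens one step later, in
time with the reset move, which leaves from `R`. -/
theorem History.sinceReset_snoc_of_mem {R : S → Prop} {u : History S} (h : R u.cur) (s : S) :
    (u.snoc s).sinceReset R = ⟨[], s⟩ := by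
  simp [History.sinceReset, History.snoc, h]

theorem History.sinceReset_snoc_of_notMem {R : S → Prop} {u : History S} (h : ¬ R u.cur) (s : S) :
    (u.snoc s).sinceReset R = (u.sinceReset R).snoc s := by
  simp [History.sinceReset, History.snoc, h]

theorem History.cur_eq_of_sinceReset_eq {R : S → Prop} {u v : History S}
    (h : u.sinceReset R = v.sinceReset R) : u.cur = v.cur := by
  simpa [History.sinceReset] using congrArg History.cur h

theorem History.cur_sinceReset (R : S → Prop) (u : History S) : (u.sinceReset R).cur = u.cur := rfl

/-- The strategy that plays `f`, restarted after each visit to a state of `R`. -/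
def restart {A : Type*} (R : S → Prop) (f : Strategy S A) : Strategy S A :=
  fun u => f (u.sinceReset R)

open Classical in
/-- The transition function that agrees with `δ`, except that it moves from the states of `R` to
`s₀`. -/
def resetStep {X : Type*} (R : S → Prop) (s₀ : S) (δ : S → X → S) (s : S) (a : X) : S :=
  if R s then s₀ else δ s a

variable (R : S → Prop) (δ : S → Finset (I ⊕ O) → S) (s₀ : S) (f : Strategy S (Finset O))

/-- Until `R` is visited nothing is truncated and both transition functions agree. Only times `j <
t` are restricted, so the first visit to `R` is still covered. -/
theorem sinceReset_inputRun_eq (w : ℕ → Finset I) (t : ℕ)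
    (h : ∀ j < t, ¬ R (inputRun δ s₀ f w j).cur) :
    (inputRun (resetStep R s₀ δ) s₀ (restart R f) w t).sinceReset R = inputRun δ s₀ f w t := by
  induction t with
  | zero => simp [inputRun, History.sinceReset]
  | succ t ih =>
    have ih := ih fun j hj => h j (lt_trans hj t.lt_succ_self)
    have hcur : (inputRun (resetStep R s₀ δ) s₀ (restart R f) w t).cur =
        (inputRun δ s₀ f w t).cur := by rw [← ih, History.cur_sinceReset]
    have hR := h t t.lt_succ_self
    rw [inputRun, History.sinceReset_snoc_of_notMem (hcur ▸ hR), ih, inputRun, restart, ih,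
      resetStep, hcur, if_neg hR]

theorem cur_inputRun_reset_eq (w : ℕ → Finset I) (t : ℕ)
    (h : ∀ j < t, ¬ R (inputRun δ s₀ f w j).cur) :
    (inputRun (resetStep R s₀ δ) s₀ (restart R f) w t).cur = (inputRun δ s₀ f w t).cur := by
  rw [← sinceReset_inputRun_eq R δ s₀ f w t h, History.cur_sinceReset]

/-- After a visit to `R`, the run of the restarted strategy starts anew. -/
theorem sinceReset_inputRun_add (w : ℕ → Finset I) (t : ℕ)
    (ht : R (inputRun (resetStep R s₀ δ) s₀ (restart R f) w t).cur) (k : ℕ) :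
    (inputRun (resetStep R s₀ δ) s₀ (restart R f) w (t + 1 + k)).sinceReset R =
      (inputRun (resetStep R s₀ δ) s₀ (restart R f) (suffix w (t + 1)) k).sinceReset R := by
  -- Full histories differ by the prefix before the reset, so the invariant compares only their
  -- truncations, on which the restarted strategy depends. The letter `w t` is consumed by the reset
  -- move, hence the shift by `t + 1`.
  induction k with
  | zero =>
    rw [add_zero, inputRun.eq_2, History.sinceReset_snoc_of_mem ht, resetStep, if_pos ht]
    simp [inputRun, History.sinceReset]
  | succ k ih =>
    have hcur : (inputRun (resetStep R s₀ δ) s₀ (restart R f) w (t + 1 + k)).cur =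
        (inputRun (resetStep R s₀ δ) s₀ (restart R f) (suffix w (t + 1)) k).cur :=
      History.cur_eq_of_sinceReset_eq ih
    have hnext : resetStep R s₀ δ (inputRun (resetStep R s₀ δ) s₀ (restart R f) w (t + 1 + k)).cur
        ((w (t + 1 + k)).disjSum
          (restart R f (inputRun (resetStep R s₀ δ) s₀ (restart R f) w (t + 1 + k)))) =
        resetStep R s₀ δ (inputRun (resetStep R s₀ δ) s₀ (restart R f) (suffix w (t + 1)) k).cur
        ((suffix w (t + 1) k).disjSum
          (restart R f (inputRun (resetStep R s₀ δ) s₀ (restart R f) (suffix w (t + 1)) k))) := by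
      rw [hcur, restart, restart, ih]; rfl
    rw [← add_assoc, inputRun, inputRun, hnext]
    by_cases hR : R (inputRun (resetStep R s₀ δ) s₀ (restart R f) w (t + 1 + k)).cur
    · rw [History.sinceReset_snoc_of_mem hR, History.sinceReset_snoc_of_mem (hcur ▸ hR)]
    · rw [History.sinceReset_snoc_of_notMem hR, History.sinceReset_snoc_of_notMem (hcur ▸ hR), ih]

/-- The mean payoff of the run generated by a strategy on an input word. -/
def inputPayoff (γ : S → ℝ) (δ : S → Finset (I ⊕ O) → S) (s₀ : S) (f : Strategy S (Finset O))
    (w : ℕ → Finset I) : ℝ :=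
  meanPayoff fun j => γ (inputRun δ s₀ f w j).cur

theorem measurable_inputPayoff [Fintype I] (γ : S → ℝ) :
    Measurable (inputPayoff (I := I) γ δ s₀ f) :=
  measurable_meanPayoff.comp <| measurable_pi_lambda _ fun j =>
    (Measurable.of_discrete (f := fun u : History S => γ u.cur)).comp
      (measurable_of_dependsOn (dependsOn_inputRun δ s₀ f j))

theorem integrable_inputPayoff [Fintype I] [Finite S] (γ : S → ℝ) :
    Integrable (inputPayoff (I := I) γ δ s₀ f) (inputMeasure I) := by
  obtain ⟨B, hB⟩ := (Set.finite_range fun s => |γ s|).bddAbove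
  refine Integrable.of_bound (measurable_inputPayoff δ s₀ f γ).aestronglyMeasurable (2 * B)
    (Eventually.of_forall fun w => ?_)
  exact abs_meanPayoff_le fun j => hB ⟨_, rfl⟩

/-- The words on which the run avoids `R`. -/
def noReset (w : ℕ → Finset I) : Prop := ∀ j, ¬ R (inputRun δ s₀ f w j).cur

/-- The renewal equation for the expected payoff of a restarted strategy. -/
theorem measureReal_noReset_mul_integral_restart [Fintype I] [Finite S] (γ : S → ℝ) :
    (inputMeasure I).real {w | noReset R δ s₀ f w} *
        ∫ w, inputPayoff γ (resetStep R s₀ δ) s₀ (restart R f) w ∂inputMeasure I =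
      ∫ w in {w | noReset R δ s₀ f w}, inputPayoff γ δ s₀ f w ∂inputMeasure I := by
  set h : (ℕ → Finset I) → ℝ := inputPayoff γ (resetStep R s₀ δ) s₀ (restart R f) with hh
  have hmeas : Measurable h := measurable_inputPayoff _ _ _ γ
  have hint : Integrable h (inputMeasure I) := integrable_inputPayoff _ _ _ γ
  obtain ⟨B, hB⟩ := (Set.finite_range fun s => |γ s|).bddAbove
  -- `T t` is the event that `R` is first visited at time `t`; the complement of `noReset` is the
  -- disjoint union of these events.
  let T : ℕ → Set (ℕ → Finset I) := fun t =>
    {w | R (inputRun δ s₀ f w t).cur ∧ ∀ j < t, ¬ R (inputRun δ s₀ f w j).cur}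
  have hT : ∀ t, DependsOn (· ∈ T t) (Set.Iio (t + 1)) := by
    intro t w w' hw
    have e : ∀ j ≤ t, inputRun δ s₀ f w j = inputRun δ s₀ f w' j := fun j hj =>
      dependsOn_inputRun δ s₀ f j fun i hi =>
        hw i (Set.mem_Iio.2 (lt_of_lt_of_le hi (hj.trans t.le_succ)))
    simp only [T, Set.mem_ofPred_eq, e t le_rfl]
    refine propext (and_congr_right fun _ => forall₂_congr fun j hj => ?_)
    rw [e j hj.le]
  have hTm : ∀ t, MeasurableSet (T t) := fun t => measurableSet_of_dependsOn (hT t)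
  have hdisj : Pairwise (Function.onFun Disjoint T) := by
    intro s t hst
    refine Set.disjoint_left.2 fun w hs ht => ?_
    rcases lt_or_gt_of_ne hst with hlt | hlt
    · exact ht.2 s hlt hs.1
    · exact hs.2 t hlt ht.1
  have hcompl : {w | noReset R δ s₀ f w} = (⋃ t, T t)ᶜ := by
    classical
    ext w
    simp only [noReset, Set.mem_ofPred_eq, Set.mem_compl_iff, Set.mem_iUnion, not_exists]
    refine ⟨fun hw t ht => hw t ht.1, fun hw j hj => ?_⟩
    have hex : ∃ t, R (inputRun δ s₀ f w t).cur := ⟨j, hj⟩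
    exact hw _ ⟨Nat.find_spec hex, fun i hi => Nat.find_min hex hi⟩
  have hUm : MeasurableSet (⋃ t, T t) := MeasurableSet.iUnion hTm
  -- On `T t` the payoff equals that of the fresh run on `suffix w (t + 1)`, by prefix independence,
  -- and this suffix is independent of `T t`.
  have hTint : ∀ t, ∫ w in T t, h w ∂inputMeasure I =
      (inputMeasure I).real (T t) * ∫ w, h w ∂inputMeasure I := by
    intro t
    rw [inputMeasure, ← setIntegral_comp_suffix _ (hT t) hmeas]
    refine setIntegral_congr_fun (hTm t) fun w hw => ?_
    have hR : R (inputRun (resetStep R s₀ δ) s₀ (restart R f) w t).cur := by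
      rw [cur_inputRun_reset_eq R δ s₀ f w t hw.2]; exact hw.1
    simp only [hh, inputPayoff]
    rw [← meanPayoff_suffix (fun j => hB ⟨_, rfl⟩) (t + 1)]
    congr 1
    funext k
    exact congrArg γ (History.cur_eq_of_sinceReset_eq (sinceReset_inputRun_add R δ s₀ f w t hR k))
  have hUint : ∫ w in ⋃ t, T t, h w ∂inputMeasure I =
      (inputMeasure I).real (⋃ t, T t) * ∫ w, h w ∂inputMeasure I := by
    rw [integral_iUnion hTm hdisj hint.integrableOn]
    simp_rw [hTint]
    rw [tsum_mul_right, measureReal_def, measure_iUnion hdisj hTm,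
      ENNReal.tsum_toReal_eq fun t => measure_ne_top _ _]
    rfl
  have hNint : ∫ w in {w | noReset R δ s₀ f w}, h w ∂inputMeasure I =
      ∫ w in {w | noReset R δ s₀ f w}, inputPayoff γ δ s₀ f w ∂inputMeasure I := by
    refine setIntegral_congr_fun (hcompl ▸ hUm.compl) fun w hw => ?_
    simp only [hh, inputPayoff]
    congr 1
    funext j
    rw [cur_inputRun_reset_eq R δ s₀ f w j fun i _ => hw i]
  -- Splitting `E[h]` over the union of the `T t` and its complement gives the renewal equation.
  have hsplit := integral_add_compl hUm hint
  rw [hUint, ← hcompl, hNint] at hsplit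
  rw [hcompl, probReal_compl_eq_one_sub hUm, ← hcompl]
  linarith

end Restart

/-! ### The reset MDP -/

/-- `A_ψ` does not read outputs, so no strategy influences whether a rejecting component is reached.
-/
theorem fst_cur_inputRun {I O : Type*} {n : ℕ} {Qψ : Type*} {Q : Fin n → Type*}
    (Aψ : DPW (Finset I) Qψ) (A : ∀ l, DPW (Finset (I ⊕ O)) (Q l)) (s₀ : Qψ × (∀ l, Q l)) (hs₀ : s₀.1 = Aψ.init)
    (f : Strategy (Qψ × (∀ l, Q l)) (Finset O)) (w : ℕ → Finset I) (j : ℕ) :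
    (inputRun (prodStep Aψ A) s₀ f w j).cur.1 = Aψ.run w j := by
  induction j with
  | zero => exact hs₀
  | succ j ih => simp [inputRun, History.snoc, prodStep, DPW.run, ih]

section ResetMDP

variable {I O : Type*} [Fintype I] {n : ℕ} {Qψ : Type*} {Q : Fin n → Type*}
  (Aψ : DPW (Finset I) Qψ) (v : Fin n → ℝ) (A : ∀ l, DPW (Finset (I ⊕ O)) (Q l))

/-- The states whose `A_ψ`-component lies in a rejecting ergodic component. -/
def IsRejectingState (s : Qψ × (∀ l, Q l)) : Prop := ∃ C, IsRejectingComponent Aψ C ∧ s.1 ∈ C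

/-- Sending every letter to the initial state pushes the uniform distribution to a point mass. So
the reset MDP is also driven by input letters, and its runs are functions of the input word. -/
theorem resetMDP_trans : (resetMDP Aψ v A).trans =
    inducedTrans (resetStep (IsRejectingState Aψ) (condMDP Aψ v A).init (prodStep Aψ A)) := by
  funext s o
  by_cases h : IsRejectingState Aψ s
  · simp only [resetMDP, inducedTrans, resetStep, if_pos h]
    exact (if_pos h).trans (PMF.map_const _ _).symm
  · simp only [resetMDP, inducedTrans, resetStep, if_neg h]
    exact if_neg h

theorem val_resetMDP [Finite Qψ] [∀ l, Finite (Q l)]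
    (g : Strategy (Qψ × (∀ l, Q l)) (Finset O)) :
    (resetMDP Aψ v A).val g = ∫ w, inputPayoff (condMDP Aψ v A).reward
      (resetStep (IsRejectingState Aψ) (condMDP Aψ v A).init (prodStep Aψ A))
      (condMDP Aψ v A).init g w ∂inputMeasure I := by
  rw [MDP.val, runMeasure_eq_map_inputRun _ _ (resetMDP_trans Aψ v A),
    integral_map (measurable_inputRun _ _ _).aemeasurable]
  · rfl
  · refine Measurable.aestronglyMeasurable (measurable_meanPayoff.comp <|
      measurable_pi_lambda (fun (r : ℕ → History _) j => (resetMDP Aψ v A).reward (r j).cur)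
        fun j => ?_)
    exact (Measurable.of_discrete
      (f := fun u : History _ => (resetMDP Aψ v A).reward u.cur)).comp (measurable_pi_apply j)

theorem setOf_sat_ae_eq_noReset [Finite Qψ] (ψ : LTL I) (hAψ : Aψ.language = {w | ψ.Sat w})
    (f : Strategy (Qψ × (∀ l, Q l)) (Finset O)) :
    {w | ψ.Sat w} =ᵐ[inputMeasure I]
      {w | noReset (IsRejectingState Aψ) (prodStep Aψ A) (condMDP Aψ v A).init f w} := by
  rw [← hAψ]
  filter_upwards [ae_mem_language_iff Aψ] with w hw
  refine propext (hw.trans ?_)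
  simp only [noReset, IsRejectingState]
  refine forall_congr' fun j => ?_
  rw [fst_cur_inputRun Aψ A _ rfl f w j]

/-- The restarted strategy attains in the reset MDP the conditional value of the strategy. -/
theorem val_restart_eq_condVal [Finite Qψ] [∀ l, Finite (Q l)] (ψ : LTL I)
    (hψ : 0 < inputMeasure I {w | ψ.Sat w}) (hAψ : Aψ.language = {w | ψ.Sat w})
    (f : Strategy (Qψ × (∀ l, Q l)) (Finset O)) :
    (resetMDP Aψ v A).val (restart (IsRejectingState Aψ) f) = condVal ψ Aψ v A f := by
  have hae := setOf_sat_ae_eq_noReset Aψ v A ψ hAψ f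
  have hren := measureReal_noReset_mul_integral_restart (IsRejectingState Aψ) (prodStep Aψ A)
    (condMDP Aψ v A).init f (condMDP Aψ v A).reward
  have hpos : (inputMeasure I).real
      {w | noReset (IsRejectingState Aψ) (prodStep Aψ A) (condMDP Aψ v A).init f w} ≠ 0 := by
    rw [← measureReal_congr hae]
    exact (ENNReal.toReal_pos hψ.ne' (measure_ne_top _ _)).ne'
  -- Conditioning is restriction scaled by the inverse probability of `ψ`. Replacing that event by
  -- the almost surely equal `noReset` event turns the goal into the renewal equation.
  rw [val_resetMDP, condVal, ProbabilityTheory.cond, integral_smul_measure,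
    Measure.restrict_congr_set hae, measure_congr hae, ENNReal.toReal_inv, smul_eq_mul,
    ← measureReal_def,
    eq_inv_mul_iff_mul_eq₀ hpos]
  exact hren

end ResetMDP

end QualSynth

end

theorem mainTheorem8 {I O : Type*} [Fintype I] [Fintype O]
    {F : (k : ℕ) → Set ((Fin k → unitInterval) → unitInterval)}
    (φ : QualSynth.FLTL (I ⊕ O) F) (ψ : QualSynth.LTL I)
    (hψ : 0 < QualSynth.inputMeasure I {w | ψ.Sat w})
    {n : ℕ} (val : Fin n → ℝ) (hmono : StrictMono val) (hval : Set.range val = φ.values)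
    {Qψ : Type*} [Finite Qψ] (Aψ : QualSynth.DPW (Finset I) Qψ)
    (hAψ : Aψ.language = {w | ψ.Sat w})
    {Q : Fin n → Type*} [∀ l, Finite (Q l)] (A : ∀ l, QualSynth.DPW (Finset (I ⊕ O)) (Q l))
    (hA : ∀ l, (A l).language = {π | (φ.sem π : ℝ) = val l})
    (v : ℝ) (f : QualSynth.Strategy (Qψ × (∀ l, Q l)) (Finset O))
    (hf : v ≤ QualSynth.condVal ψ Aψ val A f) :
    ∃ g : QualSynth.Strategy (Qψ × (∀ l, Q l)) (Finset O),
      v ≤ (QualSynth.resetMDP Aψ val A).val g :=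
  ⟨QualSynth.restart (QualSynth.IsRejectingState Aψ) f,
    hf.trans_eq (QualSynth.val_restart_eq_condVal Aψ val A ψ hψ hAψ f).symm⟩
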